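/- Let $G$ be a group, let $\mathcal C$ be the set of conjugacy classes of $G$, let $\mathfrak r:\mathcal C\to\mathbb N=\{0,1,2,\dots\}$, $C\mapsto \mathfrak r_C$, be any function (a ramification data), and let $K$ be a field. Let $S_{G,\mathfrak r}$ be the (possibly empty) subsemigroup of $G$ generated by $\bigcup_{\mathfrak r_C>0}C$; it is called a submonoid of $G$ if it contains $1_G$. Let $\Gamma_{G,\mathfrak r}$ be the Hopf graph: the directed graph with vertex set $G$ and with $\mathfrak r_C$ edges from $x$ to $xc$ for all $x\in G$, $C\in\mathcal C$ and $c\in C$. For a directed graph $E$ with vertex set $E^0$, edge set $E^1$, source map $s$ and range map $r$, let $L_K(E)$ be its Leavitt path algebra, i.e. the (not necessarily unital) associative $K$-algebra generated by the vertices $v\in E^0$, the edges $e\in E^1$ and symbols $e^*$ ($e\in E^1$), subject to $vw=\delta_{v,w}w$, $s(e)e=e=e\,r(e)$, $r(e)e^*=e^*=e^*s(e)$, $e^*f=\delta_{e,f}r(e)$ for all $v,w\in E^0$, $e,f\in E^1$, and $v=\sum_{s(e)=v}ee^*$ for every vertex $v$ with $0<|s^{-1}(v)|<\infty$. For a nonzero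 $K$-algebra $A$, let $$\operatorname{GKdim}(A)=\sup_{V}\ \limsup_{n\to\infty}\log_n\dim_K(V^n)\in[0,\infty],$$ where $V$ runs over the nonzero finite dimensional subspaces of $A$ (equivalently, over the generating finite dimensional subspaces of the finitely generated nonzero subalgebras of $A$), and $V^n$ is the linear span of all products of at least one and at most $n$ elements of $V$. Then $$\operatorname{GKdim}\bigl(L_K(\Gamma_{G,\mathfrak r})\bigr)=\begin{cases}\infty & \text{if } \sum_{C\in\mathcal C}\mathfrak r_C|C|\ge 2 \text{ and } S_{G,\mathfrak r}\text{ is a submonoid of }G;\\ 1 & \text{if } \sum_{C\in\mathcal C}\mathfrak r_C|C|=1 \text{ and } S_{G,\mathfrak r}\text{ is a submonoid of }G;\\ 0&\text{otherwise.}\end{cases}$$ Here $\sum_{C\in\mathcal C}\mathfrak r_C|C|$ is a (possibly infinite) cardinal. -/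

import Mathlib

namespace HopfLPA

universe u v w

/-- A directed graph `(E⁰, E¹, r, s)`; loops, multiple edges and infinite sets are allowed. -/
structure DirectedGraph where
  /-- the set `E⁰` of vertices -/
  Vertex : Type u
  /-- the set `E¹` of edges -/
  Edge : Type v
  /-- the source map -/
  source : Edge → Vertex
  /-- the range map -/
  range : Edge → Vertex

namespace DirectedGraph

/-- A vertex is regular if it emits at least one and only finitely many edges. -/
def IsRegular (E : DirectedGraph.{u, v}) (x : E.Vertex) : Prop :=
  (E.source ⁻¹' {x}).Nonempty ∧ (E.source ⁻¹' {x}).Finite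

/-- The generators of the Leavitt path algebra: the vertices, the (real) edges `e`, and the
ghost edges `e*`. -/
inductive Gen (E : DirectedGraph.{u, v}) : Type (max u v)
  | vertex (x : E.Vertex) : Gen E
  | edge (e : E.Edge) : Gen E
  | ghost (e : E.Edge) : Gen E

section Leavitt

variable (K : Type w) [Field K] (E : DirectedGraph.{u, v})

/-- The vertex `x` in the free algebra on the generators. -/
def freeVertex (x : E.Vertex) : FreeAlgebra K E.Gen := FreeAlgebra.ι K (Gen.vertex x)

/-- The edge `e` in the free algebra on the generators. -/
def freeEdge (e : E.Edge) : FreeAlgebra K E.Gen := FreeAlgebra.ι K (Gen.edge e)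

/-- The ghost edge `e*` in the free algebra on the generators. -/
def freeGhost (e : E.Edge) : FreeAlgebra K E.Gen := FreeAlgebra.ι K (Gen.ghost e)

/-- The defining relations of the Leavitt path algebra. -/
inductive LeavittRel : FreeAlgebra K E.Gen → FreeAlgebra K E.Gen → Prop
  | vertex_mul_self (x : E.Vertex) :
      LeavittRel (freeVertex K E x * freeVertex K E x) (freeVertex K E x)
  | vertex_mul_of_ne (x y : E.Vertex) (h : x ≠ y) :
      LeavittRel (freeVertex K E x * freeVertex K E y) 0
  | source_mul_edge (e : E.Edge) :
      LeavittRel (freeVertex K E (E.source e) * freeEdge K E e) (freeEdge K E e)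
  | edge_mul_range (e : E.Edge) :
      LeavittRel (freeEdge K E e * freeVertex K E (E.range e)) (freeEdge K E e)
  | range_mul_ghost (e : E.Edge) :
      LeavittRel (freeVertex K E (E.range e) * freeGhost K E e) (freeGhost K E e)
  | ghost_mul_source (e : E.Edge) :
      LeavittRel (freeGhost K E e * freeVertex K E (E.source e)) (freeGhost K E e)
  | ghost_mul_self (e : E.Edge) :
      LeavittRel (freeGhost K E e * freeEdge K E e) (freeVertex K E (E.range e))
  | ghost_mul_of_ne (e f : E.Edge) (h : e ≠ f) :
      LeavittRel (freeGhost K E e * freeEdge K E f) 0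
  | regular (x : E.Vertex) (h : E.IsRegular x) :
      LeavittRel (freeVertex K E x)
        (∑ e ∈ h.2.toFinset, freeEdge K E e * freeGhost K E e)

/-- The *unital* algebra presented by the generators and relations of the Leavitt path algebra,
i.e. the Leavitt path algebra with an identity element adjoined. -/
abbrev UnitalLeavitt : Type (max u v w) := RingQuot (LeavittRel K E)

/-- The class of a generator in the presented unital algebra. -/
def genClass (g : E.Gen) : UnitalLeavitt K E :=
  RingQuot.mkAlgHom K (LeavittRel K E) (FreeAlgebra.ι K g)

/-- The Leavitt path algebra `L_K(E)`. This algebra need not have an identity element: it is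
presented, as a not necessarily unital algebra, by the generators `v`, `e`, `e*` and the relations
`LeavittRel`. None of these relations has a constant term, so the unital algebra with the same
presentation is its unitization, in which it is the non-unital subalgebra spanned by the nonempty
words in the generators. -/
def LeavittPathAlgebra : NonUnitalSubalgebra K (UnitalLeavitt K E) :=
  NonUnitalAlgebra.adjoin K (Set.range (genClass K E))

end Leavitt

end DirectedGraph

section GelfandKirillov

variable (K : Type u) [Field K] {A : Type v} [NonUnitalRing A] [Module K A]
  [IsScalarTower K A A] [SMulCommClass K A A]

/-- For a subspace `V` of an algebra, `powLE K V n` is the subspace `Vⁿ` spanned by all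
products `v₁ ⋯ v_k` with `1 ≤ k ≤ n` and all `v_i ∈ V`. -/
def powLE (V : Submodule K A) : ℕ → Submodule K A
  | 0 => ⊥
  | n + 1 => V ⊔ Submodule.map₂ (LinearMap.mul K A) (powLE V n) V

/-- The number `limsup_{n → ∞} log_n (dim Vⁿ)`, for a finite dimensional subspace `V`. -/
noncomputable def growthExponent (V : Submodule K A) : EReal :=
  Filter.limsup
    (fun n : ℕ => ((Real.logb (n : ℝ) (Module.finrank K (powLE K V n) : ℝ) : ℝ) : EReal))
    Filter.atTop

variable (A) in
/-- The Gelfand–Kirillov dimension of a (not necessarily unital, not necessarily finitely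
generated) algebra `A`: the supremum, over the finitely generated subalgebras `B` of `A` and the
finite dimensional subspaces `V` generating `B`, of `limsup_{n → ∞} log_n (dim Vⁿ)`.
(If `B ≠ 0`, the latter number depends on `B` only, and it is the Gelfand–Kirillov dimension of `B`;
for `V = B = 0` it is `0` here, which does not matter for a nonzero algebra `A`.) -/
noncomputable def gkDim : EReal :=
  ⨆ (B : NonUnitalSubalgebra K A) (V : Submodule K A) (_ : V.FG)
    (_ : NonUnitalAlgebra.adjoin K (V : Set A) = B), growthExponent K V

end GelfandKirillov

section Hopf

variable {G : Type u} [Group G]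

/-- The Hopf graph of a group `G` with ramification data `r`: the vertices are the elements of `G`,
and for all `x ∈ G` and `c ∈ G` there are `r_C` edges from `x` to `x * c`, where `C` is the
conjugacy class of `c`. -/
def hopfGraph (r : ConjClasses G → ℕ) : DirectedGraph.{u, u} where
  Vertex := G
  Edge := G × (Σ c : G, Fin (r (ConjClasses.mk c)))
  source e := e.1
  range e := e.1 * e.2.1

/-- The subsemigroup of `G` generated by the union of the conjugacy classes in the support of `r`;
it is empty if `r = 0`. -/
def hopfSemigroup (r : ConjClasses G → ℕ) : Subsemigroup G :=
  Subsemigroup.closure (⋃ C ∈ {C : ConjClasses G | 0 < r C}, C.carrier)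

/-- A subsemigroup of `G` is a submonoid if it is the underlying set of a submonoid of `G`. -/
def IsSubmonoidOf (S : Subsemigroup G) : Prop :=
  ∃ M : Submonoid G, (M : Set G) = (S : Set G)

/-- The (possibly infinite) cardinal `∑_C r_C |C|`, the sum being over all conjugacy classes. -/
noncomputable def ramificationSum (r : ConjClasses G → ℕ) : Cardinal.{u} :=
  Cardinal.sum fun C : ConjClasses G => (r C : Cardinal.{u}) * Cardinal.mk C.carrier

end Hopf

end HopfLPA

/-! Every vertex of the Hopf graph emits one edge per label, and the number of labels is
`ramificationSum r` (`mk_label`). The identity lies in `hopfSemigroup r` exactly when some nonempty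
word of labels has product 1. Since left translation preserves the graph, such a word is then a
closed path at every vertex.

If the identity is not in the semigroup, the graph has no cycles (`nodup_of_isChain`). Words in
finitely many generators reduce to monomials p z q* with p, q lists of distinct edges, so they span
a finite dimensional space and the dimension is 0 (`gkDim_eq_zero_of_acyclic`).

If there is exactly one label, each vertex emits a single edge, so e e* is a vertex and every
nonzero nonempty word is a path or a ghost path, determined by its start and its length. This bounds
growth linearly (`gkDim_le_one_of_subsingleton`). Powers of a closed path give the matching lower
bound (`one_le_gkDim_of_closed_word`).

If there is a closed word w and a label d different from its first letter, the paths w^a₁ d w^a₂ d ⋯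
with k + 1 blocks are pairwise different. They yield polynomial growth of every degree k
(`gkDim_eq_top_of_closed_word`), although the finite dimensional subspace used depends on k.

Both lower bounds need distinct paths to be linearly independent. This is read off from an action on
infinite paths (`pathRep`, `linearIndependent_pathElem`). -/

namespace HopfLPA

/-! ### Growth exponents and Gelfand–Kirillov dimension -/

section GrowthOfSubspaces

variable {K : Type*} [Field K]

section NonUnital

variable {A B : Type*} [NonUnitalRing A] [Module K A] [IsScalarTower K A A] [SMulCommClass K A A]
  [NonUnitalRing B] [Module K B] [IsScalarTower K B B] [SMulCommClass K B B]

theorem map_powLE (f : A →ₙₐ[K] B) (V : Submodule K A) (n : ℕ) :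
    (powLE K V n).map (f : A →ₗ[K] B) = powLE K (V.map (f : A →ₗ[K] B)) n := by
  induction n with
  | zero => simp [powLE]
  | succ n ih =>
    simp only [powLE, Submodule.map_sup]
    congr 1
    rw [← ih]
    apply le_antisymm
    · rw [Submodule.map_le_iff_le_comap, Submodule.map₂_le]
      intro a ha b hb
      simp only [LinearMap.mul_apply', Submodule.mem_comap]
      have : (f : A →ₗ[K] B) (a * b) = (f : A →ₗ[K] B) a * (f : A →ₗ[K] B) b := map_mul f a b
      rw [this]
      exact Submodule.apply_mem_map₂ (LinearMap.mul K B) (Submodule.mem_map_of_mem ha)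
        (Submodule.mem_map_of_mem hb)
    · rw [Submodule.map₂_le]
      rintro _ ⟨a, ha, rfl⟩ _ ⟨b, hb, rfl⟩
      exact ⟨a * b, Submodule.apply_mem_map₂ (LinearMap.mul K A) ha hb, map_mul f a b⟩

/-- An injective homomorphism preserves the dimension of each power. Hence growth can be computed in
the ambient unital algebra instead of in the subtype `L`; the next two lemmas exploit this for lower
and upper bounds. -/
theorem growthExponent_map (f : A →ₙₐ[K] B) (hf : Function.Injective f) (V : Submodule K A) :
    growthExponent K (V.map (f : A →ₗ[K] B)) = growthExponent K V := by
  unfold growthExponent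
  congr 1
  funext n
  rw [← map_powLE, LinearEquiv.finrank_eq
    (Submodule.equivMapOfInjective (f : A →ₗ[K] B) hf (powLE K V n)).symm]

theorem growthExponent_le_gkDim (L : NonUnitalSubalgebra K A) (V : Submodule K A) (hV : V.FG)
    (hVL : V ≤ L.toSubmodule) : growthExponent K V ≤ gkDim K L := by
  let f : L →ₙₐ[K] A := NonUnitalSubalgebraClass.subtype L
  have hmap : (V.comap (f : L →ₗ[K] A)).map (f : L →ₗ[K] A) = V := by
    apply Submodule.map_comap_eq_self
    intro x hx
    exact ⟨⟨x, hVL hx⟩, rfl⟩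
  have hinj : Function.Injective f := Subtype.val_injective
  have hfg : (V.comap (f : L →ₗ[K] A)).FG :=
    Submodule.fg_of_fg_map_injective (f : L →ₗ[K] A) hinj (by rwa [hmap])
  rw [← hmap, growthExponent_map f hinj]
  unfold gkDim
  exact le_iSup_of_le _ (le_iSup_of_le _ (le_iSup_of_le hfg (le_iSup_of_le rfl le_rfl)))

theorem gkDim_le (L : NonUnitalSubalgebra K A) (a : EReal)
    (h : ∀ V : Submodule K A, V.FG → V ≤ L.toSubmodule → growthExponent K V ≤ a) :
    gkDim K L ≤ a := by
  unfold gkDim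
  refine iSup_le fun _ => iSup_le fun V => iSup_le fun hV => iSup_le fun _ => ?_
  let f : L →ₙₐ[K] A := NonUnitalSubalgebraClass.subtype L
  rw [← growthExponent_map f Subtype.val_injective]
  refine h _ (hV.map _) ?_
  rintro _ ⟨x, _, rfl⟩
  exact x.2

theorem gkDim_nonneg : 0 ≤ gkDim K A := by
  have h0 : ∀ n, powLE K (⊥ : Submodule K A) n = ⊥ := by
    intro n
    induction n with
    | zero => rfl
    | succ n ih => simp [powLE]
  have : growthExponent K (⊥ : Submodule K A) = 0 := by
    have h1 : ∀ n, Module.finrank K (powLE K (⊥ : Submodule K A) n) = 0 := fun n => by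
      rw [h0, finrank_bot]
    -- The convention `Real.logb n 0 = 0` makes the zero subspace contribute 0.
    simp [growthExponent, h1]
  unfold gkDim
  rw [← this]
  exact le_iSup_of_le _ (le_iSup_of_le _ (le_iSup_of_le Submodule.fg_bot
    (le_iSup_of_le rfl le_rfl)))

theorem powLE_fg (V : Submodule K A) (hV : V.FG) (n : ℕ) : (powLE K V n).FG := by
  induction n with
  | zero => exact Submodule.fg_bot
  | succ n ih => exact hV.sup (ih.map₂ _ hV)

theorem powLE_mono_succ (V : Submodule K A) (n : ℕ) : powLE K V n ≤ powLE K V (n + 1) := by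
  induction n with
  | zero => exact bot_le
  | succ n ih => exact sup_le_sup_left (Submodule.map₂_le_map₂_left ih) V

theorem powLE_mono (V : Submodule K A) : Monotone (powLE K V) :=
  monotone_nat_of_le_succ (powLE_mono_succ V)

theorem mul_mem_powLE (V : Submodule K A) {m : ℕ} {x y : A} (hx : x ∈ powLE K V m) (hy : y ∈ V) :
    x * y ∈ powLE K V (m + 1) :=
  Submodule.mem_sup_right (Submodule.apply_mem_map₂ (LinearMap.mul K A) hx hy)

theorem mem_powLE_one (V : Submodule K A) {x : A} (hx : x ∈ V) : x ∈ powLE K V 1 :=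
  Submodule.mem_sup_left hx

/-- A constant has log_n tending to 0. Comparing with C + 1 keeps the numerator nonnegative even
when C = 0. -/
theorem growthExponent_le_zero (V : Submodule K A) (C : ℕ)
    (h : ∀ n, Module.finrank K (powLE K V n) ≤ C) : growthExponent K V ≤ 0 := by
  have hlim : Filter.Tendsto (fun n : ℕ => Real.log (C + 1 : ℝ) / Real.log (n : ℝ))
      Filter.atTop (nhds 0) :=
    (Real.tendsto_log_atTop.comp tendsto_natCast_atTop_atTop).const_div_atTop _
  have hlim' := (continuous_coe_real_ereal.tendsto 0).comp hlim
  have := hlim'.limsup_eq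
  unfold growthExponent
  rw [← EReal.coe_zero, ← this]
  refine Filter.limsup_le_limsup ?_
  · filter_upwards [Filter.eventually_gt_atTop 1] with n hn
    have hn' : (1 : ℝ) < n := by exact_mod_cast hn
    simp only [Function.comp, EReal.coe_le_coe_iff, Real.logb]
    refine div_le_div_of_nonneg_right ?_ (Real.log_nonneg hn'.le)
    rcases Nat.eq_zero_or_pos (Module.finrank K (powLE K V n)) with h0 | h0
    · rw [h0, Nat.cast_zero, Real.log_zero]
      exact Real.log_nonneg (by linarith [Nat.cast_nonneg (α := ℝ) C])
    · apply Real.log_le_log (by exact_mod_cast h0)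
      exact_mod_cast (h n).trans (Nat.le_succ C)

theorem growthExponent_le_one (V : Submodule K A) (C : ℕ)
    (h : ∀ n, 1 ≤ n → Module.finrank K (powLE K V n) ≤ C * n) : growthExponent K V ≤ 1 := by
  have hlim : Filter.Tendsto (fun n : ℕ => Real.log (C + 1 : ℝ) / Real.log (n : ℝ) + 1)
      Filter.atTop (nhds (0 + 1)) :=
    ((Real.tendsto_log_atTop.comp tendsto_natCast_atTop_atTop).const_div_atTop _).add_const 1
  rw [zero_add] at hlim
  have hlim' := (continuous_coe_real_ereal.tendsto 1).comp hlim
  have := hlim'.limsup_eq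
  unfold growthExponent
  rw [← EReal.coe_one, ← this]
  refine Filter.limsup_le_limsup ?_
  · filter_upwards [Filter.eventually_gt_atTop 1] with n hn
    have hn' : (1 : ℝ) < n := by exact_mod_cast hn
    have hlog := Real.log_pos hn'
    have hC : (0 : ℝ) ≤ C := Nat.cast_nonneg C
    simp only [Function.comp, EReal.coe_le_coe_iff, Real.logb]
    rw [div_add_one hlog.ne', ← Real.log_mul (by positivity) (by positivity)]
    refine div_le_div_of_nonneg_right ?_ hlog.le
    rcases Nat.eq_zero_or_pos (Module.finrank K (powLE K V n)) with h0 | h0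
    · rw [h0, Nat.cast_zero, Real.log_zero]
      exact Real.log_nonneg (by nlinarith)
    · apply Real.log_le_log (by exact_mod_cast h0)
      have := h n hn.le
      have h' : (Module.finrank K (powLE K V n) : ℝ) ≤ C * n := by exact_mod_cast this
      linarith

/-- A polynomial lower bound of degree `d` along infinitely many `n` bounds the growth exponent
from below. -/
theorem le_growthExponent (V : Submodule K A) (d : ℕ)
    (h : ∀ N : ℕ, ∃ n ≥ N, n ^ d ≤ Module.finrank K (powLE K V n)) :
    ((d : ℝ) : EReal) ≤ growthExponent K V := by
  unfold growthExponent
  refine Filter.le_limsup_of_frequently_le ?_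
  · rw [Filter.frequently_atTop]
    intro N
    obtain ⟨n, hn, hd⟩ := h (max N 2)
    refine ⟨n, (le_max_left _ _).trans hn, ?_⟩
    have h2 : 2 ≤ n := (le_max_right _ _).trans hn
    have hn' : (1 : ℝ) < n := by exact_mod_cast h2
    have hd' : (n : ℝ) ^ d ≤ Module.finrank K (powLE K V n) := by exact_mod_cast hd
    have hp : (0 : ℝ) < (n : ℝ) ^ d := by positivity
    rw [EReal.coe_le_coe_iff, Real.le_logb_iff_rpow_le hn' (hp.trans_le hd'), Real.rpow_natCast]
    exact hd'

end NonUnital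

section Unital

variable {U : Type*} [Ring U] [Algebra K U]

/-- Once 1 is in P, products of at most n factors are also products of exactly n factors, so the
ordinary powers of submodules apply. -/
theorem powLE_le_pow (V P : Submodule K U) (hP : 1 ≤ P) (hV : V ≤ P) (n : ℕ) :
    powLE K V n ≤ P ^ n := by
  induction n with
  | zero => exact bot_le
  | succ n ih =>
    refine sup_le ?_ ?_
    · exact hV.trans (by
        simpa using pow_le_pow_right₀ hP (Nat.succ_le_succ (Nat.zero_le n)))
    · rw [pow_succ, Submodule.map₂_le]
      intro a ha b hb
      exact Submodule.mul_mem_mul (ih ha) (hV hb)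

end Unital

end GrowthOfSubspaces

end HopfLPA

/-! ### Relations and words in the Leavitt path algebra -/

namespace HopfLPA

namespace DirectedGraph

universe u v w

variable (K : Type w) [Field K] (E : DirectedGraph.{u, v})

/-- The vertex `x` in the Leavitt path algebra. -/
noncomputable def vert (x : E.Vertex) : UnitalLeavitt K E := genClass K E (Gen.vertex x)

/-- The real edge `e` in the Leavitt path algebra. -/
noncomputable def real (e : E.Edge) : UnitalLeavitt K E := genClass K E (Gen.edge e)

/-- The ghost edge `e*` in the Leavitt path algebra. -/
noncomputable def star (e : E.Edge) : UnitalLeavitt K E := genClass K E (Gen.ghost e)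

section Relations

theorem mkAlgHom_freeVertex (x : E.Vertex) :
    RingQuot.mkAlgHom K (LeavittRel K E) (freeVertex K E x) = vert K E x := rfl

theorem mkAlgHom_freeEdge (e : E.Edge) :
    RingQuot.mkAlgHom K (LeavittRel K E) (freeEdge K E e) = real K E e := rfl

theorem mkAlgHom_freeGhost (e : E.Edge) :
    RingQuot.mkAlgHom K (LeavittRel K E) (freeGhost K E e) = star K E e := rfl

theorem vert_mul_self (x : E.Vertex) : vert K E x * vert K E x = vert K E x := by
  simpa only [map_mul, mkAlgHom_freeVertex] using
    RingQuot.mkAlgHom_rel K (LeavittRel.vertex_mul_self (K := K) x)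

theorem vert_mul_of_ne {x y : E.Vertex} (h : x ≠ y) : vert K E x * vert K E y = 0 := by
  simpa only [map_mul, mkAlgHom_freeVertex, map_zero] using
    RingQuot.mkAlgHom_rel K (LeavittRel.vertex_mul_of_ne (K := K) x y h)

theorem source_mul_real (e : E.Edge) : vert K E (E.source e) * real K E e = real K E e := by
  simpa only [map_mul, mkAlgHom_freeVertex, mkAlgHom_freeEdge] using
    RingQuot.mkAlgHom_rel K (LeavittRel.source_mul_edge (K := K) e)

theorem real_mul_range (e : E.Edge) : real K E e * vert K E (E.range e) = real K E e := by
  simpa only [map_mul, mkAlgHom_freeVertex, mkAlgHom_freeEdge] using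
    RingQuot.mkAlgHom_rel K (LeavittRel.edge_mul_range (K := K) e)

theorem range_mul_star (e : E.Edge) : vert K E (E.range e) * star K E e = star K E e := by
  simpa only [map_mul, mkAlgHom_freeVertex, mkAlgHom_freeGhost] using
    RingQuot.mkAlgHom_rel K (LeavittRel.range_mul_ghost (K := K) e)

theorem star_mul_source (e : E.Edge) : star K E e * vert K E (E.source e) = star K E e := by
  simpa only [map_mul, mkAlgHom_freeVertex, mkAlgHom_freeGhost] using
    RingQuot.mkAlgHom_rel K (LeavittRel.ghost_mul_source (K := K) e)

theorem star_mul_real_self (e : E.Edge) : star K E e * real K E e = vert K E (E.range e) := by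
  simpa only [map_mul, mkAlgHom_freeVertex, mkAlgHom_freeGhost, mkAlgHom_freeEdge] using
    RingQuot.mkAlgHom_rel K (LeavittRel.ghost_mul_self (K := K) e)

theorem star_mul_real_of_ne {e f : E.Edge} (h : e ≠ f) : star K E e * real K E f = 0 := by
  simpa only [map_mul, mkAlgHom_freeGhost, mkAlgHom_freeEdge, map_zero] using
    RingQuot.mkAlgHom_rel K (LeavittRel.ghost_mul_of_ne (K := K) e f h)

theorem vert_eq_sum (x : E.Vertex) (h : E.IsRegular x) :
    vert K E x = ∑ e ∈ h.2.toFinset, real K E e * star K E e := by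
  simpa only [map_mul, map_sum, mkAlgHom_freeVertex, mkAlgHom_freeGhost, mkAlgHom_freeEdge] using
    RingQuot.mkAlgHom_rel K (LeavittRel.regular (K := K) x h)

variable {E}

theorem vert_mul_real_of_ne {x : E.Vertex} {e : E.Edge} (h : x ≠ E.source e) :
    vert K E x * real K E e = 0 := by
  rw [← source_mul_real, ← mul_assoc, vert_mul_of_ne K E h, zero_mul]

theorem real_mul_vert_of_ne {x : E.Vertex} {e : E.Edge} (h : E.range e ≠ x) :
    real K E e * vert K E x = 0 := by
  rw [← real_mul_range, mul_assoc, vert_mul_of_ne K E h, mul_zero]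

theorem vert_mul_star_of_ne {x : E.Vertex} {e : E.Edge} (h : x ≠ E.range e) :
    vert K E x * star K E e = 0 := by
  rw [← range_mul_star, ← mul_assoc, vert_mul_of_ne K E h, zero_mul]

theorem star_mul_vert_of_ne {x : E.Vertex} {e : E.Edge} (h : E.source e ≠ x) :
    star K E e * vert K E x = 0 := by
  rw [← star_mul_source, mul_assoc, vert_mul_of_ne K E h, mul_zero]

theorem real_mul_real_of_ne {e f : E.Edge} (h : E.range e ≠ E.source f) :
    real K E e * real K E f = 0 := by
  rw [← source_mul_real K E f, ← mul_assoc, real_mul_vert_of_ne K h, zero_mul]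

theorem star_mul_star_of_ne {e f : E.Edge} (h : E.source e ≠ E.range f) :
    star K E e * star K E f = 0 := by
  rw [← range_mul_star K E f, ← mul_assoc, star_mul_vert_of_ne K h, zero_mul]

end Relations

section Words

/-- The span of `1` and the classes of the generators in `F`. -/
noncomputable def letterSpan (F : Finset E.Gen) : Submodule K (UnitalLeavitt K E) :=
  1 ⊔ Submodule.span K (genClass K E '' F)

theorem one_le_letterSpan (F : Finset E.Gen) : 1 ≤ letterSpan K E F := le_sup_left

theorem letterSpan_fg (F : Finset E.Gen) : (letterSpan K E F).FG := by
  refine Submodule.FG.sup ?_ (Submodule.fg_span (F.finite_toSet.image _))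
  rw [Submodule.one_eq_span]
  exact Submodule.fg_span_singleton _

variable {E}

theorem letterSpan_mono {F F' : Finset E.Gen} (h : F ⊆ F') :
    letterSpan K E F ≤ letterSpan K E F' :=
  sup_le_sup_left (Submodule.span_mono (Set.image_mono (by exact_mod_cast h))) _

theorem letterSpan_pow_mono {F F' : Finset E.Gen} (h : F ⊆ F') {l l' : ℕ} (hl : l ≤ l') :
    letterSpan K E F ^ l ≤ letterSpan K E F' ^ l' :=
  (pow_le_pow_left' (letterSpan_mono K h) l).trans
    (pow_le_pow_right₀ (one_le_letterSpan K E F') hl)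

theorem exists_mem_letterSpan_pow {x : UnitalLeavitt K E} (hx : x ∈ LeavittPathAlgebra K E) :
    ∃ (F : Finset E.Gen) (l : ℕ), x ∈ letterSpan K E F ^ l := by
  classical
  unfold LeavittPathAlgebra at hx
  induction hx using NonUnitalAlgebra.adjoin_induction with
  | mem x hx =>
    obtain ⟨g, rfl⟩ := hx
    refine ⟨{g}, 1, ?_⟩
    rw [pow_one]
    exact Submodule.mem_sup_right (Submodule.subset_span ⟨g, by simp, rfl⟩)
  | add x y _ _ hx hy =>
    obtain ⟨F, l, hx⟩ := hx
    obtain ⟨F', l', hy⟩ := hy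
    exact ⟨F ∪ F', max l l', add_mem
      (letterSpan_pow_mono K Finset.subset_union_left (le_max_left _ _) hx)
      (letterSpan_pow_mono K Finset.subset_union_right (le_max_right _ _) hy)⟩
  | zero => exact ⟨∅, 0, zero_mem _⟩
  | mul x y _ _ hx hy =>
    obtain ⟨F, l, hx⟩ := hx
    obtain ⟨F', l', hy⟩ := hy
    refine ⟨F ∪ F', l + l', ?_⟩
    rw [pow_add]
    exact Submodule.mul_mem_mul (letterSpan_pow_mono K Finset.subset_union_left le_rfl hx)
      (letterSpan_pow_mono K Finset.subset_union_right le_rfl hy)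
  | smul a x _ hx =>
    obtain ⟨F, l, hx⟩ := hx
    exact ⟨F, l, Submodule.smul_mem _ a hx⟩

/-- Finitely many elements involve finitely many generators in words of bounded length. Upper bounds
for the powers of V thus reduce to bounds for words in a finite alphabet. -/
theorem exists_le_letterSpan_pow (V : Submodule K (UnitalLeavitt K E)) (hV : V.FG)
    (hVL : V ≤ (LeavittPathAlgebra K E).toSubmodule) :
    ∃ (F : Finset E.Gen) (l : ℕ), V ≤ letterSpan K E F ^ l := by
  classical
  obtain ⟨S, rfl⟩ := hV
  rw [Submodule.span_le] at hVL
  have : ∃ (F : Finset E.Gen) (l : ℕ), 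
      (S : Set (UnitalLeavitt K E)) ⊆ ((letterSpan K E F ^ l : Submodule K _) : Set _) := by
    induction S using Finset.induction_on with
    | empty => exact ⟨∅, 0, by simp⟩
    | insert a S _ ih =>
      simp only [Finset.coe_insert, Set.insert_subset_iff] at hVL ⊢
      obtain ⟨F, l, h⟩ := ih hVL.2
      obtain ⟨F', l', h'⟩ := exists_mem_letterSpan_pow K hVL.1
      exact ⟨F ∪ F', max l l', letterSpan_pow_mono K Finset.subset_union_right (le_max_right _ _) h',
        h.trans (letterSpan_pow_mono K Finset.subset_union_left (le_max_left _ _))⟩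
  obtain ⟨F, l, h⟩ := this
  exact ⟨F, l, Submodule.span_le.2 h⟩

/-- An increasing sequence of subspaces that contains `1` and is compatible with right
multiplication by the generators in `F` contains all words in these generators. -/
theorem letterSpan_pow_le (F : Finset E.Gen) (W : ℕ → Submodule K (UnitalLeavitt K E))
    (h1 : 1 ∈ W 0) (hW : Monotone W)
    (hmul : ∀ n, ∀ g ∈ F, ∀ x ∈ W n, x * genClass K E g ∈ W (n + 1)) (n : ℕ) :
    letterSpan K E F ^ n ≤ W n := by
  induction n with
  | zero => rwa [pow_zero, Submodule.one_le]
  | succ n ih =>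
    rw [pow_succ, letterSpan, Submodule.mul_sup, mul_one]
    refine sup_le (ih.trans (hW n.le_succ)) ?_
    rw [Submodule.mul_le]
    intro x hx y hy
    induction hy using Submodule.span_induction with
    | mem y hy =>
      obtain ⟨g, hg, rfl⟩ := hy
      exact hmul n g hg x (ih hx)
    | zero => simp
    | add a b _ _ ha hb => rw [mul_add]; exact add_mem ha hb
    | smul a b _ hb => rw [mul_smul_comm]; exact Submodule.smul_mem _ _ hb

end Words

end DirectedGraph

end HopfLPA

/-! ### The representation on infinite paths -/

namespace HopfLPA

open DirectedGraph

universe u w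

section Representation

variable {G : Type u} [Group G] (r : ConjClasses G → ℕ)

/-- The edge labels of the Hopf graph: every vertex emits one edge for each label. -/
abbrev Label : Type u := Σ c : G, Fin (r (ConjClasses.mk c))

/-- The edge with source `x` and label `t`. -/
def hopfEdge (x : G) (t : Label r) : (hopfGraph r).Edge := (x, t)

@[simp] theorem source_hopfEdge (x : G) (t : Label r) :
    (hopfGraph r).source (hopfEdge r x t) = x := rfl

@[simp] theorem range_hopfEdge (x : G) (t : Label r) :
    (hopfGraph r).range (hopfEdge r x t) = x * t.1 := rfl

/-- Infinite paths with a degree, as a basis of a module over the Leavitt path algebra. -/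
abbrev PathBasis : Type u := G × ℤ × (ℕ → Label r)

variable (K : Type w) [Field K]

open Classical in
/-- A vertex, acting as a projection. -/
noncomputable def vertOp (x : G) : Module.End K (PathBasis r →₀ K) :=
  Finsupp.lsum ℕ fun b => if b.1 = x then Finsupp.lsingle b else 0

/-- Prepend a letter to an infinite word. -/
def consWord {T : Type*} (t : T) (s : ℕ → T) : ℕ → T
  | 0 => t
  | n + 1 => s n

open Classical in
/-- An edge, acting by prepending. -/
noncomputable def edgeOp (x : G) (t : Label r) : Module.End K (PathBasis r →₀ K) :=
  Finsupp.lsum ℕ fun b =>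
    if b.1 = x * t.1 then Finsupp.lsingle (x, b.2.1 + 1, consWord t b.2.2) else 0

open Classical in
/-- A ghost edge, acting by deleting the first edge. -/
noncomputable def ghostOp (x : G) (t : Label r) : Module.End K (PathBasis r →₀ K) :=
  Finsupp.lsum ℕ fun b =>
    if b.1 = x ∧ b.2.2 0 = t then Finsupp.lsingle (x * t.1, b.2.1 - 1, fun n => b.2.2 (n + 1))
    else 0

open Classical in
theorem vertOp_single (x y : G) (k : ℤ) (s : ℕ → Label r) :
    vertOp r K x (Finsupp.single (y, k, s) 1) =
      if y = x then Finsupp.single (y, k, s) 1 else 0 := by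
  simp only [vertOp, Finsupp.lsum_single]
  split_ifs <;> rfl

open Classical in
theorem edgeOp_single (x y : G) (t : Label r) (k : ℤ) (s : ℕ → Label r) :
    edgeOp r K x t (Finsupp.single (y, k, s) 1) =
      if y = x * t.1 then Finsupp.single (x, k + 1, consWord t s) 1 else 0 := by
  simp only [edgeOp, Finsupp.lsum_single]
  split_ifs <;> rfl

open Classical in
theorem ghostOp_single (x y : G) (t : Label r) (k : ℤ) (s : ℕ → Label r) :
    ghostOp r K x t (Finsupp.single (y, k, s) 1) =
      if y = x ∧ s 0 = t then Finsupp.single (x * t.1, k - 1, fun n => s (n + 1)) 1 else 0 := by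
  simp only [ghostOp, Finsupp.lsum_single]
  split_ifs <;> rfl

/-- The operators of the generators. -/
noncomputable def genOp : (hopfGraph r).Gen → Module.End K (PathBasis r →₀ K)
  | .vertex x => vertOp r K x
  | .edge e => edgeOp r K e.1 e.2
  | .ghost e => ghostOp r K e.1 e.2

theorem end_ext {X : Type*} {f g : Module.End K (X →₀ K)}
    (h : ∀ b, f (Finsupp.single b 1) = g (Finsupp.single b 1)) : f = g :=
  Finsupp.lhom_ext' fun b => LinearMap.ext_ring (h b)

theorem vertOp_mul_vertOp (x : G) : vertOp r K x * vertOp r K x = vertOp r K x := by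
  refine end_ext K fun ⟨y, k, s⟩ => ?_
  by_cases hy : y = x <;> simp [vertOp_single, hy]

theorem vertOp_mul_vertOp_of_ne {x y : G} (hxy : x ≠ y) : vertOp r K x * vertOp r K y = 0 := by
  refine end_ext K fun ⟨z, k, s⟩ => ?_
  by_cases hz : z = y
  · subst hz
    simp [vertOp_single, hxy.symm]
  · simp [vertOp_single, hz]

open Classical in
-- Deleting the first edge and restoring it projects onto the infinite paths that begin with this
-- edge.
theorem edgeOp_mul_ghostOp_single (x z : G) (t : Label r) (k : ℤ) (s : ℕ → Label r) :
    (edgeOp r K x t * ghostOp r K x t) (Finsupp.single (z, k, s) 1) =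
      if t = s 0 then vertOp r K x (Finsupp.single (z, k, s) 1) else 0 := by
  by_cases ht : t = s 0
  · have hs : consWord t (fun n => s (n + 1)) = s := by
      funext n
      cases n with
      | zero => exact ht
      | succ n => rfl
    subst ht
    by_cases hz : z = x <;> simp [ghostOp_single, edgeOp_single, vertOp_single, hz, hs]
  · simp [ghostOp_single, ht, Ne.symm (Ne.intro ht)]

theorem lift_genOp_rel {a b : FreeAlgebra K (hopfGraph r).Gen}
    (h : LeavittRel K (hopfGraph r) a b) :
    FreeAlgebra.lift K (genOp r K) a = FreeAlgebra.lift K (genOp r K) b := by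
  classical
  induction h with
  | vertex_mul_self x =>
    simp only [map_mul, freeVertex, FreeAlgebra.lift_ι_apply, genOp]
    exact vertOp_mul_vertOp r K x
  | vertex_mul_of_ne x y hxy =>
    simp only [map_mul, freeVertex, FreeAlgebra.lift_ι_apply, genOp, map_zero]
    exact vertOp_mul_vertOp_of_ne r K hxy
  | source_mul_edge e =>
    obtain ⟨x, t⟩ := e
    simp only [map_mul, freeVertex, freeEdge, FreeAlgebra.lift_ι_apply, genOp]
    refine end_ext K fun ⟨z, k, s⟩ => ?_
    by_cases hz : z = x * t.1 <;> simp [vertOp_single, edgeOp_single, hz, hopfGraph]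
  | edge_mul_range e =>
    obtain ⟨x, t⟩ := e
    simp only [map_mul, freeVertex, freeEdge, FreeAlgebra.lift_ι_apply, genOp]
    refine end_ext K fun ⟨z, k, s⟩ => ?_
    by_cases hz : z = x * t.1 <;> simp [vertOp_single, edgeOp_single, hz, hopfGraph]
  | range_mul_ghost e =>
    obtain ⟨x, t⟩ := e
    simp only [map_mul, freeVertex, freeGhost, FreeAlgebra.lift_ι_apply, genOp]
    refine end_ext K fun ⟨z, k, s⟩ => ?_
    by_cases hz : z = x ∧ s 0 = t <;> simp [vertOp_single, ghostOp_single, hz, hopfGraph]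
  | ghost_mul_source e =>
    obtain ⟨x, t⟩ := e
    simp only [map_mul, freeVertex, freeGhost, FreeAlgebra.lift_ι_apply, genOp]
    refine end_ext K fun ⟨z, k, s⟩ => ?_
    by_cases hz : z = x <;> simp [vertOp_single, ghostOp_single, hz, hopfGraph]
  | ghost_mul_self e =>
    obtain ⟨x, t⟩ := e
    simp only [map_mul, freeVertex, freeGhost, freeEdge, FreeAlgebra.lift_ι_apply, genOp]
    refine end_ext K fun ⟨z, k, s⟩ => ?_
    by_cases hz : z = x * t.1 <;>
      simp [vertOp_single, ghostOp_single, edgeOp_single, hz, hopfGraph, consWord]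
  | ghost_mul_of_ne e f hef =>
    obtain ⟨x, t⟩ := e
    obtain ⟨y, q⟩ := f
    simp only [map_mul, map_zero, freeGhost, freeEdge, FreeAlgebra.lift_ι_apply, genOp]
    refine end_ext K fun ⟨z, k, s⟩ => ?_
    by_cases hz : z = y * q.1
    · have : ¬ (y = x ∧ q = t) := by
        rintro ⟨rfl, rfl⟩
        exact hef rfl
      simp [ghostOp_single, edgeOp_single, hz, consWord, this]
    · simp [edgeOp_single, hz]
  | regular x hx =>
    simp only [map_mul, map_sum, freeVertex, freeGhost, freeEdge, FreeAlgebra.lift_ι_apply, genOp]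
    refine end_ext K fun ⟨z, k, s⟩ => ?_
    -- An infinite path from x begins with exactly one edge, so a single summand of the relation at
    -- a regular vertex survives.
    have hterm : ∀ e ∈ hx.2.toFinset,
        (edgeOp r K e.1 e.2 * ghostOp r K e.1 e.2) (Finsupp.single (z, k, s) 1) =
          if e = hopfEdge r x (s 0) then vertOp r K x (Finsupp.single (z, k, s) 1) else 0 := by
      intro e he
      have hex : e.1 = x := hx.2.mem_toFinset.1 he
      have hiff : e = hopfEdge r x (s 0) ↔ e.2 = s 0 :=
        ⟨fun h => congrArg Prod.snd h, fun h => Prod.ext hex h⟩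
      rw [edgeOp_mul_ghostOp_single, hex]
      simp only [hiff]
    have hmem : hopfEdge r x (s 0) ∈ hx.2.toFinset := hx.2.mem_toFinset.2 rfl
    rw [LinearMap.sum_apply, Finset.sum_congr rfl hterm, Finset.sum_ite_eq', if_pos hmem]

/-- The Leavitt path algebra of the Hopf graph acts on the infinite paths. -/
noncomputable def pathRep :
    UnitalLeavitt K (hopfGraph r) →ₐ[K] Module.End K (PathBasis r →₀ K) :=
  RingQuot.liftAlgHom K ⟨FreeAlgebra.lift K (genOp r K), fun _ _ h => lift_genOp_rel r K h⟩

theorem pathRep_genClass (g : (hopfGraph r).Gen) :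
    pathRep r K (genClass K (hopfGraph r) g) = genOp r K g := by
  simp [pathRep, genClass]

end Representation

/-! ### Paths and their linear independence -/

section Paths

variable {G : Type u} [Group G] (r : ConjClasses G → ℕ)

/-- The group element by which a word of labels multiplies. -/
def wordProd (p : List (Label r)) : G := (p.map Sigma.fst).prod

@[simp] theorem wordProd_nil : wordProd r [] = 1 := rfl

@[simp] theorem wordProd_cons (t : Label r) (p : List (Label r)) :
    wordProd r (t :: p) = t.1 * wordProd r p := by simp [wordProd]

@[simp] theorem wordProd_append (p q : List (Label r)) :
    wordProd r (p ++ q) = wordProd r p * wordProd r q := by simp [wordProd]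

variable (K : Type w) [Field K]

/-- The path that starts in `x` and has the labels `p`. -/
noncomputable def pathElem (x : G) : List (Label r) → UnitalLeavitt K (hopfGraph r)
  | [] => vert K (hopfGraph r) x
  | t :: p => real K (hopfGraph r) (hopfEdge r x t) * pathElem (x * t.1) p

theorem vert_mul_pathElem (x : G) (p : List (Label r)) :
    vert K (hopfGraph r) x * pathElem r K x p = pathElem r K x p := by
  cases p with
  | nil => exact vert_mul_self K (hopfGraph r) x
  | cons t p =>
    rw [pathElem, ← mul_assoc]
    congr 1
    exact source_mul_real K (hopfGraph r) (hopfEdge r x t)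

theorem pathElem_mul (x : G) (p q : List (Label r)) :
    pathElem r K x p * pathElem r K (x * wordProd r p) q = pathElem r K x (p ++ q) := by
  induction p generalizing x with
  | nil =>
    rw [wordProd_nil, mul_one, List.nil_append]
    exact vert_mul_pathElem r K x q
  | cons t p ih =>
    rw [List.cons_append, pathElem, pathElem, ← ih (x * t.1), wordProd_cons, mul_assoc, mul_assoc]

theorem pathElem_mem (x : G) (p : List (Label r)) :
    pathElem r K x p ∈ LeavittPathAlgebra K (hopfGraph r) := by
  induction p generalizing x with
  | nil => exact NonUnitalAlgebra.subset_adjoin K ⟨_, rfl⟩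
  | cons t p ih =>
    exact mul_mem (NonUnitalAlgebra.subset_adjoin K ⟨_, rfl⟩) (ih _)

/-- Prepend a finite word to an infinite one. -/
def appendWord {T : Type*} : List T → (ℕ → T) → ℕ → T
  | [], s => s
  | t :: p, s => consWord t (appendWord p s)

theorem appendWord_inj {T : Type*} (s : ℕ → T) {p q : List T} (hl : p.length = q.length)
    (h : appendWord p s = appendWord q s) : p = q := by
  induction p generalizing q with
  | nil => exact (List.length_eq_zero_iff.1 hl.symm).symm
  | cons t p ih =>
    cases q with
    | nil => simp at hl
    | cons t' q =>
      have h0 : t = t' := congrFun h 0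
      have h1 : appendWord p s = appendWord q s := funext fun n => congrFun h (n + 1)
      rw [h0, ih (by simpa using hl) h1]

theorem pathRep_pathElem (x : G) (p : List (Label r)) (k : ℤ) (s : ℕ → Label r) :
    pathRep r K (pathElem r K x p) (Finsupp.single (x * wordProd r p, k, s) 1) =
      Finsupp.single (x, k + p.length, appendWord p s) 1 := by
  classical
  induction p generalizing x with
  | nil => simp [pathElem, vert, pathRep_genClass, genOp, vertOp_single, appendWord]
  | cons t p ih =>
    have := ih (x * t.1)
    rw [wordProd_cons, ← mul_assoc, pathElem, map_mul, Module.End.mul_apply, this, real,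
      pathRep_genClass, genOp]
    change edgeOp r K x t _ = _
    rw [edgeOp_single, if_pos rfl]
    simp [appendWord, add_assoc]

/-- A common endpoint allows all these paths to act on one basis vector, which they send to distinct
basis vectors. The degree coordinate recovers the length of the path; without it, prefixes of
different lengths of a constant infinite word could not be told apart. -/
theorem linearIndependent_pathElem [Nonempty (Label r)] (x y : G) {ι : Type*}
    (p : ι → List (Label r)) (hp : Function.Injective p) (hy : ∀ i, wordProd r (p i) = y) :
    LinearIndependent K fun i => pathElem r K x (p i) := by
  obtain ⟨t⟩ := ‹Nonempty (Label r)›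
  let s : ℕ → Label r := fun _ => t
  let f : UnitalLeavitt K (hopfGraph r) →ₗ[K] PathBasis r →₀ K :=
    (LinearMap.applyₗ (Finsupp.single (x * y, 0, s) 1)).comp (pathRep r K).toLinearMap
  apply LinearIndependent.of_comp f
  let g : ι → PathBasis r := fun i => (x, 0 + ((p i).length : ℤ), appendWord (p i) s)
  have hg : Function.Injective g := by
    intro i j hij
    simp only [g, Prod.mk.injEq, true_and, zero_add, Nat.cast_inj] at hij
    exact hp (appendWord_inj s hij.1 hij.2)
  have : (f ∘ fun i => pathElem r K x (p i)) = fun i => Finsupp.single (g i) (1 : K) := by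
    funext i
    have := pathRep_pathElem r K x (p i) 0 s
    rw [hy i] at this
    exact this
  rw [this]
  exact (Finsupp.linearIndependent_single_one K (PathBasis r)).comp g hg

end Paths

end HopfLPA

/-! ### Acyclic graphs: dimension zero -/

namespace HopfLPA

namespace DirectedGraph

universe u v w

variable (K : Type w) [Field K] (E : DirectedGraph.{u, v})

/-- The product of a list of real edges. -/
noncomputable def realProd (p : List E.Edge) : UnitalLeavitt K E := (p.map (real K E)).prod

/-- The product of the ghosts of a list of edges, in reverse order. -/
noncomputable def starProd : List E.Edge → UnitalLeavitt K E
  | [] => 1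
  | e :: q => starProd q * star K E e

variable {E}

/-- Two edges are composable. -/
def Composable (e f : E.Edge) : Prop := E.range e = E.source f

theorem realProd_eq_zero {p : List E.Edge} (h : ¬ p.IsChain Composable) : realProd K E p = 0 := by
  induction p with
  | nil => exact absurd List.IsChain.nil h
  | cons e p ih =>
    cases p with
    | nil => exact absurd (List.IsChain.singleton e) h
    | cons f p =>
      rw [List.isChain_cons_cons, not_and_or] at h
      rcases h with h | h
      · simp [realProd, ← mul_assoc, real_mul_real_of_ne K h]
      · have := ih h
        rw [realProd, List.map_cons, List.prod_cons, ← realProd, this, mul_zero]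

theorem starProd_eq_zero {p : List E.Edge} (h : ¬ p.IsChain Composable) : starProd K E p = 0 := by
  induction p with
  | nil => exact absurd List.IsChain.nil h
  | cons e p ih =>
    cases p with
    | nil => exact absurd (List.IsChain.singleton e) h
    | cons f p =>
      rw [List.isChain_cons_cons, not_and_or] at h
      rcases h with h | h
      · simp [starProd, mul_assoc, star_mul_star_of_ne K (Ne.symm h)]
      · rw [starProd, ih h, zero_mul]

/-- The lists of edges in `F`. -/
def edgeLists (F : Finset E.Edge) : Set (List E.Edge) := {p | ∀ e ∈ p, e ∈ F}

/-- The identity and the vertices in `F`. -/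
def unitSet (F : Finset E.Vertex) : Set (UnitalLeavitt K E) := insert 1 (vert K E '' F)

/-- The monomials with edges in `FE` and vertices in `FV`. -/
def monomials (FE : Finset E.Edge) (FV : Finset E.Vertex) : Set (UnitalLeavitt K E) :=
  {x | ∃ p ∈ edgeLists FE, ∃ z ∈ unitSet K FV, ∃ q ∈ edgeLists FE,
    x = realProd K E p * z * starProd K E q}

variable {K}

section Closed

variable {FE : Finset E.Edge} {FV : Finset E.Vertex}

/-- The vertex is absorbed by the last ghost edge, or by the middle factor if there is none, unless
the product vanishes. The middle factor is needed because an empty list of edges gives 1 and not a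
vertex. -/
theorem monomial_mul_vert {x : UnitalLeavitt K E} (hx : x ∈ monomials K FE FV) {v : E.Vertex}
    (hv : v ∈ FV) : x * vert K E v = 0 ∨ x * vert K E v ∈ monomials K FE FV := by
  obtain ⟨p, hp, z, hz, q, hq, rfl⟩ := hx
  cases q with
  | nil =>
    simp only [starProd, mul_one]
    rcases hz with rfl | ⟨w, hw, rfl⟩
    · exact .inr ⟨p, hp, _, .inr ⟨v, hv, rfl⟩, [], by simp [edgeLists], by simp [starProd]⟩
    · by_cases h : w = v
      · subst h
        exact .inr ⟨p, hp, _, .inr ⟨w, hw, rfl⟩, [], by simp [edgeLists],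
          by simp [starProd, mul_assoc, vert_mul_self]⟩
      · exact .inl (by rw [mul_assoc, vert_mul_of_ne K E h, mul_zero])
  | cons f q =>
    by_cases h : E.source f = v
    · subst h
      exact .inr ⟨p, hp, z, hz, f :: q, hq, by simp [starProd, mul_assoc, star_mul_source]⟩
    · exact .inl (by simp [starProd, mul_assoc, star_mul_vert_of_ne K h])

/-- A real edge either extends p or meets the last ghost edge. In the latter case a nonzero product
leaves the vertex f* f = r(f), which is why the ranges have to be in `FV`. -/
theorem monomial_mul_real {x : UnitalLeavitt K E} (hx : x ∈ monomials K FE FV) {e : E.Edge}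
    (he : e ∈ FE) (hr : E.range e ∈ FV) :
    x * real K E e = 0 ∨ x * real K E e ∈ monomials K FE FV := by
  obtain ⟨p, hp, z, hz, q, hq, rfl⟩ := hx
  cases q with
  | nil =>
    have hmem : realProd K E p * real K E e ∈ monomials K FE FV := by
      refine ⟨p ++ [e], ?_, 1, .inl rfl, [], by simp [edgeLists], by simp [realProd, starProd]⟩
      intro f hf
      rcases List.mem_append.1 hf with hf | hf
      · exact hp f hf
      · rwa [List.mem_singleton.1 hf]
    simp only [starProd, mul_one]
    rcases hz with rfl | ⟨w, hw, rfl⟩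
    · rw [mul_one]
      exact .inr hmem
    · by_cases h : w = E.source e
      · subst h
        rw [mul_assoc, source_mul_real]
        exact .inr hmem
      · exact .inl (by rw [mul_assoc, vert_mul_real_of_ne K h, mul_zero])
  | cons f q =>
    by_cases h : f = e
    · subst h
      have : realProd K E p * z * starProd K E (f :: q) * real K E f =
          realProd K E p * z * starProd K E q * vert K E (E.range f) := by
        simp [starProd, mul_assoc, star_mul_real_self]
      rw [this]
      exact monomial_mul_vert ⟨p, hp, z, hz, q, fun e he => hq e (List.mem_cons_of_mem _ he), rfl⟩ hr
    · exact .inl (by simp [starProd, mul_assoc, star_mul_real_of_ne K E h])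

theorem monomial_mul_star {x : UnitalLeavitt K E} (hx : x ∈ monomials K FE FV) {e : E.Edge}
    (he : e ∈ FE) : x * star K E e ∈ monomials K FE FV := by
  obtain ⟨p, hp, z, hz, q, hq, rfl⟩ := hx
  refine ⟨p, hp, z, hz, e :: q, ?_, by simp [starProd, mul_assoc]⟩
  intro f hf
  rcases List.mem_cons.1 hf with rfl | hf
  · exact he
  · exact hq f hf

end Closed

/-- A property of right multiplication on a spanning set passes to the span. -/
theorem mul_mem_span {S T : Set (UnitalLeavitt K E)} {g : UnitalLeavitt K E}
    (h : ∀ x ∈ S, x * g = 0 ∨ x * g ∈ T) :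
    ∀ x ∈ Submodule.span K S, x * g ∈ Submodule.span K T := by
  intro x hx
  induction hx using Submodule.span_induction with
  | mem x hx =>
    rcases h x hx with h | h
    · rw [h]; exact zero_mem _
    · exact Submodule.subset_span h
  | zero => simp
  | add a b _ _ ha hb => rw [add_mul]; exact add_mem ha hb
  | smul c a _ ha => rw [smul_mul_assoc]; exact Submodule.smul_mem _ _ ha

theorem finite_nodup_edgeLists (F : Finset E.Edge) :
    {p : List E.Edge | p ∈ edgeLists F ∧ p.Nodup}.Finite := by
  classical
  have := Fintype.finite (fintypeNodupList (α := F))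
  refine (Set.finite_range fun l : {l : List F // l.Nodup} => l.1.map Subtype.val).subset ?_
  rintro p ⟨hp, hn⟩
  lift p to List F using hp
  exact ⟨⟨p, hn.of_map _⟩, rfl⟩

/-- Monomials with a non-composable list vanish. The remaining lists have no repetition, and a
finite alphabet admits finitely many of those. -/
theorem span_monomials_fg (hE : ∀ p : List E.Edge, p.IsChain Composable → p.Nodup)
    (FE : Finset E.Edge) (FV : Finset E.Vertex) :
    (Submodule.span K (monomials K FE FV)).FG := by
  let N := {p : List E.Edge | p ∈ edgeLists FE ∧ p.Nodup}
  have hN : N.Finite := finite_nodup_edgeLists FE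
  have hZ : (unitSet K FV).Finite := (FV.finite_toSet.image _).insert 1
  let S : Set (UnitalLeavitt K E) :=
    (fun x : List E.Edge × UnitalLeavitt K E × List E.Edge =>
      realProd K E x.1 * x.2.1 * starProd K E x.2.2) '' (N ×ˢ (unitSet K FV ×ˢ N))
  have hS : S.Finite := (hN.prod (hZ.prod hN)).image _
  have : Submodule.span K (monomials K FE FV) = Submodule.span K S := by
    apply le_antisymm
    · rw [Submodule.span_le]
      rintro _ ⟨p, hp, z, hz, q, hq, rfl⟩
      by_cases h : p.IsChain Composable
      · by_cases h' : q.IsChain Composable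
        · exact Submodule.subset_span ⟨(p, z, q), ⟨⟨hp, hE p h⟩, hz, ⟨hq, hE q h'⟩⟩, rfl⟩
        · simp [starProd_eq_zero K h']
      · simp [realProd_eq_zero K h]
    · apply Submodule.span_mono
      rintro _ ⟨⟨p, z, q⟩, ⟨hp, hz, hq⟩, rfl⟩
      exact ⟨p, hp.1, z, hz, q, hq.1, rfl⟩
  rw [this]
  exact Submodule.fg_span hS

/-- The words in finitely many generators span a finite dimensional space if the graph is
acyclic. -/
theorem exists_fg_letterSpan_pow_le (hE : ∀ p : List E.Edge, p.IsChain Composable → p.Nodup)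
    (F : Finset E.Gen) :
    ∃ W : Submodule K (UnitalLeavitt K E), W.FG ∧ ∀ n, letterSpan K E F ^ n ≤ W := by
  classical
  let FE : Finset E.Edge := F.biUnion fun
    | .vertex _ => ∅
    | .edge e => {e}
    | .ghost e => {e}
  let FV : Finset E.Vertex := (F.biUnion fun
    | .vertex x => {x}
    | .edge _ => ∅
    | .ghost _ => ∅) ∪ FE.image E.range
  -- The span of the monomials is closed under right multiplication by the generators in F, so a
  -- constant sequence of subspaces works.
  refine ⟨_, span_monomials_fg hE FE FV,
    fun n => letterSpan_pow_le K F (fun _ => Submodule.span K (monomials K FE FV)) ?_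
      monotone_const ?_ n⟩
  · exact Submodule.subset_span ⟨[], by simp [edgeLists], 1, .inl rfl, [], by simp [edgeLists],
      by simp [realProd, starProd]⟩
  · intro _ g hg
    apply mul_mem_span
    intro x hx
    cases g with
    | vertex v =>
      exact monomial_mul_vert hx
        (Finset.mem_union_left _ (Finset.mem_biUnion.2 ⟨_, hg, Finset.mem_singleton_self v⟩))
    | edge e =>
      have he : e ∈ FE := Finset.mem_biUnion.2 ⟨_, hg, Finset.mem_singleton_self e⟩
      exact monomial_mul_real hx he (Finset.mem_union_right _ (Finset.mem_image_of_mem _ he))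
    | ghost e =>
      exact .inr (monomial_mul_star hx
        (Finset.mem_biUnion.2 ⟨_, hg, Finset.mem_singleton_self e⟩))

theorem gkDim_eq_zero_of_acyclic (hE : ∀ p : List E.Edge, p.IsChain Composable → p.Nodup) :
    gkDim K (LeavittPathAlgebra K E) = 0 := by
  refine le_antisymm (gkDim_le _ _ fun V hV hVL => ?_) gkDim_nonneg
  obtain ⟨F, l, hl⟩ := exists_le_letterSpan_pow K V hV hVL
  obtain ⟨W, hW, hFW⟩ := exists_fg_letterSpan_pow_le (K := K) hE F
  have : Module.Finite K W := Module.Finite.iff_fg.2 hW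
  refine growthExponent_le_zero V (Module.finrank K W) fun n => Submodule.finrank_mono ?_
  refine (powLE_le_pow V _ (one_le_pow₀ (one_le_letterSpan K E F)) hl n).trans ?_
  rw [← pow_mul]
  exact hFW _

end DirectedGraph

end HopfLPA

/-! ### One label: at most linear growth -/

namespace HopfLPA

open DirectedGraph

universe u w

section OneLabel

variable {G : Type u} [Group G] (r : ConjClasses G → ℕ) (K : Type w) [Field K] (t : Label r)

/-- The path of length `n` that starts in `x` and uses the label `t` only. -/
noncomputable def fwd (x : G) : ℕ → UnitalLeavitt K (hopfGraph r)
  | 0 => vert K (hopfGraph r) x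
  | n + 1 => fwd x n * real K (hopfGraph r) (hopfEdge r (x * t.1 ^ n) t)

/-- The ghost path of length `n` that starts in `x` and uses the label `t` only. -/
noncomputable def bwd (x : G) : ℕ → UnitalLeavitt K (hopfGraph r)
  | 0 => vert K (hopfGraph r) x
  | n + 1 => bwd x n * star K (hopfGraph r) (hopfEdge r (x * (t.1 ^ (n + 1))⁻¹) t)

variable {t}

theorem fwd_mul_vert (x : G) (n : ℕ) :
    fwd r K t x n * vert K (hopfGraph r) (x * t.1 ^ n : G) = fwd r K t x n := by
  cases n with
  | zero =>
    rw [pow_zero, mul_one]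
    exact vert_mul_self K (hopfGraph r) x
  | succ n =>
    have := real_mul_range K (hopfGraph r) (hopfEdge r (x * t.1 ^ n) t)
    rw [range_hopfEdge] at this
    rw [fwd, mul_assoc, pow_succ, ← mul_assoc x, this]

theorem bwd_mul_vert (x : G) (n : ℕ) :
    bwd r K t x n * vert K (hopfGraph r) (x * (t.1 ^ n)⁻¹ : G) = bwd r K t x n := by
  cases n with
  | zero =>
    rw [pow_zero, inv_one, mul_one]
    exact vert_mul_self K (hopfGraph r) x
  | succ n =>
    have := star_mul_source K (hopfGraph r) (hopfEdge r (x * (t.1 ^ (n + 1))⁻¹) t)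
    rw [source_hopfEdge] at this
    rw [bwd, mul_assoc, this]

/-- The edge is the only one its source emits, so the relation at this regular vertex has a single
summand. -/
theorem real_mul_star_self [Subsingleton (Label r)] (e : (hopfGraph r).Edge) :
    real K (hopfGraph r) e * star K (hopfGraph r) e
      = vert K (hopfGraph r) ((hopfGraph r).source e) := by
  have huniq : (hopfGraph r).source ⁻¹' {(hopfGraph r).source e} = {e} := by
    ext f
    refine ⟨fun hf => ?_, fun hf => by rw [Set.mem_singleton_iff.1 hf]; rfl⟩
    exact Prod.ext hf (Subsingleton.elim _ _)
  have hreg : (hopfGraph r).IsRegular ((hopfGraph r).source e) := by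
    unfold DirectedGraph.IsRegular
    rw [huniq]
    exact ⟨Set.singleton_nonempty e, Set.finite_singleton e⟩
  rw [vert_eq_sum K (hopfGraph r) _ hreg]
  have : hreg.2.toFinset = {e} := by
    ext f
    rw [Set.Finite.mem_toFinset, huniq]
    simp
  rw [this, Finset.sum_singleton]

/-- The paths and the ghost paths of length at most `n` that start in `F`, and `1`. -/
def oneLabelSet (t : Label r) (F : Finset G) (n : ℕ) : Set (UnitalLeavitt K (hopfGraph r)) :=
  insert 1 {y | ∃ x ∈ F, ∃ m ≤ n, y = fwd r K t x m ∨ y = bwd r K t x m}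

theorem oneLabelSet_mono (F : Finset G) : Monotone (oneLabelSet r K t F) := by
  intro n n' h
  apply Set.insert_subset_insert
  rintro y ⟨x, hx, m, hm, hy⟩
  exact ⟨x, hx, m, hm.trans h, hy⟩

/-- Every word of positive length in the generators is a path or a ghost path if there is one
label only. -/
theorem oneLabel_mul_gen [Subsingleton (Label r)] (x : G) (m : ℕ)
    {y : UnitalLeavitt K (hopfGraph r)}
    (hy : y = fwd r K t x m ∨ y = bwd r K t x m) (g : (hopfGraph r).Gen) :
    y * genClass K (hopfGraph r) g = 0 ∨
      ∃ m' ≤ m + 1, y * genClass K (hopfGraph r) g = fwd r K t x m' ∨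
        y * genClass K (hopfGraph r) g = bwd r K t x m' := by
  have hedge : ∀ e : (hopfGraph r).Edge, e = hopfEdge r e.1 t :=
    fun e => Prod.ext rfl (Subsingleton.elim _ _)
  cases g with
  | vertex v =>
    change y * vert K (hopfGraph r) v = 0 ∨ _
    rcases hy with rfl | rfl
    · by_cases h : x * t.1 ^ m = v
      · subst h
        exact .inr ⟨m, m.le_succ, .inl (fwd_mul_vert r K x m)⟩
      · left
        rw [← fwd_mul_vert, mul_assoc, vert_mul_of_ne K (hopfGraph r) h, mul_zero]
    · by_cases h : x * (t.1 ^ m)⁻¹ = v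
      · subst h
        exact .inr ⟨m, m.le_succ, .inr (bwd_mul_vert r K x m)⟩
      · left
        rw [← bwd_mul_vert, mul_assoc, vert_mul_of_ne K (hopfGraph r) h, mul_zero]
  | edge e =>
    change y * real K (hopfGraph r) e = 0 ∨
      ∃ m' ≤ m + 1, y * real K (hopfGraph r) e = _ ∨ y * real K (hopfGraph r) e = _
    rw [hedge e]
    generalize (e.1 : G) = z
    have hfwd : ∀ n, fwd r K t x n * real K (hopfGraph r) (hopfEdge r z t) = 0 ∨
        fwd r K t x n * real K (hopfGraph r) (hopfEdge r z t) = fwd r K t x (n + 1) := by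
      intro n
      by_cases h : x * t.1 ^ n = z
      · subst h
        exact .inr rfl
      · left
        rw [← fwd_mul_vert, mul_assoc, vert_mul_real_of_ne K (e := hopfEdge r z t) h, mul_zero]
    rcases hy with rfl | rfl
    · rcases hfwd m with h | h
      · exact .inl h
      · exact .inr ⟨m + 1, le_rfl, .inl h⟩
    · cases m with
      -- `bwd` of length 0 is the vertex x, which is also `fwd` of length 0, so here an edge begins
      -- a real path.
      | zero =>
        rcases hfwd 0 with h | h
        · exact .inl h
        · exact .inr ⟨1, le_rfl, .inl h⟩
      | succ m =>
        by_cases h : x * (t.1 ^ (m + 1))⁻¹ = z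
        · subst h
          refine .inr ⟨m, by omega, .inr ?_⟩
          rw [bwd, mul_assoc, star_mul_real_self, range_hopfEdge]
          have : x * (t.1 ^ (m + 1))⁻¹ * t.1 = x * (t.1 ^ m)⁻¹ := by
            rw [pow_succ']
            group
          rw [this, bwd_mul_vert]
        · left
          rw [← bwd_mul_vert, mul_assoc, vert_mul_real_of_ne K (e := hopfEdge r z t) h, mul_zero]
  | ghost e =>
    change y * star K (hopfGraph r) e = 0 ∨
      ∃ m' ≤ m + 1, y * star K (hopfGraph r) e = _ ∨ y * star K (hopfGraph r) e = _
    rw [hedge e]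
    generalize (e.1 : G) = z
    have hbwd : ∀ n, bwd r K t x n * star K (hopfGraph r) (hopfEdge r z t) = 0 ∨
        bwd r K t x n * star K (hopfGraph r) (hopfEdge r z t) = bwd r K t x (n + 1) := by
      intro n
      by_cases h : x * (t.1 ^ n)⁻¹ = z * t.1
      · obtain rfl : x * (t.1 ^ (n + 1))⁻¹ = z := by
          rw [pow_succ', mul_inv_rev, ← mul_assoc, h, mul_inv_cancel_right]
        exact .inr rfl
      · left
        rw [← bwd_mul_vert, mul_assoc, vert_mul_star_of_ne K (e := hopfEdge r z t) h, mul_zero]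
    rcases hy with rfl | rfl
    · cases m with
      | zero =>
        rcases hbwd 0 with h | h
        · exact .inl h
        · exact .inr ⟨1, le_rfl, .inr h⟩
      | succ m =>
        by_cases h : x * t.1 ^ m = z
        · subst h
          refine .inr ⟨m, by omega, .inl ?_⟩
          rw [fwd, mul_assoc, real_mul_star_self, source_hopfEdge, fwd_mul_vert]
        · left
          have hne : x * t.1 ^ (m + 1) ≠ z * t.1 := by
            rw [pow_succ, ← mul_assoc]
            exact fun h' => h (mul_right_cancel h')
          rw [← fwd_mul_vert, mul_assoc, vert_mul_star_of_ne K (e := hopfEdge r z t) hne, mul_zero]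
    · rcases hbwd m with h | h
      · exact .inl h
      · exact .inr ⟨m + 1, le_rfl, .inr h⟩

theorem exists_gen_eq_oneLabel [Subsingleton (Label r)] (g : (hopfGraph r).Gen) :
    ∃ x : G, ∃ m ≤ 1, genClass K (hopfGraph r) g = fwd r K t x m ∨
      genClass K (hopfGraph r) g = bwd r K t x m := by
  have hedge : ∀ e : (hopfGraph r).Edge, e = hopfEdge r e.1 t :=
    fun e => Prod.ext rfl (Subsingleton.elim _ _)
  cases g with
  | vertex v => exact ⟨v, 0, by omega, .inl rfl⟩
  | edge e =>
    refine ⟨e.1, 1, le_rfl, .inl ?_⟩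
    change real K (hopfGraph r) e = _
    rw [hedge e]
    generalize (e.1 : G) = z
    rw [fwd, fwd, pow_zero, mul_one]
    exact (source_mul_real K (hopfGraph r) (hopfEdge r z t)).symm
  | ghost e =>
    obtain ⟨z, hz⟩ : ∃ z : G, e = hopfEdge r z t := ⟨_, hedge e⟩
    refine ⟨z * t.1, 1, le_rfl, .inr ?_⟩
    change star K (hopfGraph r) e = _
    rw [hz, bwd, bwd, zero_add, pow_one, mul_inv_cancel_right]
    exact (range_mul_star K (hopfGraph r) (hopfEdge r z t)).symm

open Classical in
/-- The elements of `oneLabelSet`, as a finite set. -/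
noncomputable def oneLabelFinset (t : Label r) (F : Finset G) (n : ℕ) :
    Finset (UnitalLeavitt K (hopfGraph r)) :=
  insert 1 ((F ×ˢ Finset.range (n + 1)).image (fun x => fwd r K t x.1 x.2) ∪
    (F ×ˢ Finset.range (n + 1)).image (fun x => bwd r K t x.1 x.2))

theorem coe_oneLabelFinset (F : Finset G) (n : ℕ) :
    (oneLabelFinset r K t F n : Set (UnitalLeavitt K (hopfGraph r))) = oneLabelSet r K t F n := by
  classical
  ext y
  simp only [oneLabelFinset, oneLabelSet, Finset.mem_coe, Finset.mem_insert, Finset.mem_union,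
    Finset.mem_image, Finset.mem_product, Finset.mem_range, Set.mem_insert_iff, Set.mem_ofPred_eq,
    Prod.exists, Nat.lt_succ_iff]
  refine or_congr_right ⟨?_, ?_⟩
  · rintro (⟨x, m, ⟨hx, hm⟩, h⟩ | ⟨x, m, ⟨hx, hm⟩, h⟩)
    · exact ⟨x, hx, m, hm, .inl h.symm⟩
    · exact ⟨x, hx, m, hm, .inr h.symm⟩
  · rintro ⟨x, hx, m, hm, h | h⟩
    · exact .inl ⟨x, m, ⟨hx, hm⟩, h.symm⟩
    · exact .inr ⟨x, m, ⟨hx, hm⟩, h.symm⟩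

theorem card_oneLabelFinset_le (F : Finset G) (n : ℕ) :
    (oneLabelFinset r K t F n).card ≤ 2 * (F.card * (n + 1)) + 1 := by
  classical
  unfold oneLabelFinset
  refine (Finset.card_insert_le _ _).trans (Nat.add_le_add_right ?_ 1)
  refine (Finset.card_union_le _ _).trans ?_
  rw [two_mul]
  exact add_le_add (Finset.card_image_le.trans (by simp)) (Finset.card_image_le.trans (by simp))

theorem exists_letterSpan_pow_le_span [Subsingleton (Label r)] (t : Label r)
    (A : Finset (hopfGraph r).Gen) :
    ∃ F : Finset G, ∀ n, letterSpan K (hopfGraph r) A ^ n ≤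
      Submodule.span K (oneLabelFinset r K t F n : Set (UnitalLeavitt K (hopfGraph r))) := by
  classical
  -- Right multiplication never changes the starting vertex of a nonempty word, so the starting
  -- vertices of the letters suffice.
  choose s hs using exists_gen_eq_oneLabel r K (t := t)
  refine ⟨A.image s, fun n => ?_⟩
  refine letterSpan_pow_le K A 
    (fun n => Submodule.span K (oneLabelFinset r K t (A.image s) n : Set _)) ?_ ?_ ?_ n
  · rw [coe_oneLabelFinset]
    exact Submodule.subset_span (Set.mem_insert _ _)
  · intro n n' h
    simp only [coe_oneLabelFinset]
    exact Submodule.span_mono (oneLabelSet_mono r K _ h)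
  · intro n g hg y hy
    simp only [coe_oneLabelFinset] at hy ⊢
    induction hy using Submodule.span_induction with
    | mem y hy =>
      rcases hy with rfl | ⟨x, hx, m, hm, hy⟩
      · obtain ⟨m, hm, h⟩ := hs g
        rw [one_mul]
        exact Submodule.subset_span (.inr ⟨s g, Finset.mem_image_of_mem _ hg, m, by omega, h⟩)
      · rcases oneLabel_mul_gen r K x m hy g with h | ⟨m', hm', h⟩
        · rw [h]
          exact zero_mem _
        · exact Submodule.subset_span (.inr ⟨x, hx, m', by omega, h⟩)
    | zero => simp
    | add a b _ _ ha hb => rw [add_mul]; exact add_mem ha hb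
    | smul c a _ ha => rw [smul_mul_assoc]; exact Submodule.smul_mem _ _ ha

theorem gkDim_le_one_of_subsingleton [Subsingleton (Label r)] (t : Label r) :
    gkDim K (LeavittPathAlgebra K (hopfGraph r)) ≤ 1 := by
  refine gkDim_le _ _ fun V hV hVL => ?_
  obtain ⟨A, l, hl⟩ := exists_le_letterSpan_pow K V hV hVL
  obtain ⟨F, hF⟩ := exists_letterSpan_pow_le_span r K t A
  -- Words of length at most l n span at most 2|F|(l n + 1) + 1 dimensions. As n ≥ 1, replacing both
  -- summands 1 by n gives this constant times n.
  refine growthExponent_le_one V (2 * (F.card * (l + 1)) + 1) fun n hn => ?_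
  have hle : powLE K V n ≤
      Submodule.span K (oneLabelFinset r K t F (l * n) : Set (UnitalLeavitt K (hopfGraph r))) := by
    refine (powLE_le_pow V _ (one_le_pow₀ (one_le_letterSpan K (hopfGraph r) A)) hl n).trans ?_
    rw [← pow_mul]
    exact hF _
  calc Module.finrank K (powLE K V n)
      ≤ _ := Submodule.finrank_mono hle
    _ ≤ _ := finrank_span_finset_le_card _
    _ ≤ 2 * (F.card * (l * n + 1)) + 1 := card_oneLabelFinset_le r K F _
    _ ≤ 2 * (F.card * (l * n + n)) + n := by gcongr
    _ = _ := by ring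

end OneLabel

end HopfLPA

/-! ### Closed words and lower bounds for growth -/

namespace HopfLPA

open DirectedGraph

universe u w

section Words

variable {T : Type*}

/-- The word `w` repeated `a` times. -/
def repWord (w : List T) (a : ℕ) : List T := (List.replicate a w).flatten

theorem repWord_succ (w : List T) (a : ℕ) : repWord w (a + 1) = w ++ repWord w a := by
  simp [repWord, List.replicate_succ]

theorem repWord_succ' (w : List T) (a : ℕ) : repWord w (a + 1) = repWord w a ++ w := by
  simp [repWord, List.replicate_succ']

theorem repWord_injective {w : List T} (hw : w ≠ []) : Function.Injective (repWord w) := by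
  intro a b h
  have := congrArg List.length h
  simpa [repWord, hw] using this

/-- The word `w ^ a₁ d w ^ a₂ d ⋯ w ^ aₖ d`. -/
def blockWord (w : List T) (d : T) : List ℕ → List T
  | [] => []
  | a :: l => repWord w a ++ d :: blockWord w d l

/-- Since t ≠ d, the next letter decides between another copy of the repeated word and the
separator, so the decomposition can be read from the left. It does not matter whether d occurs
inside w. -/
theorem repWord_append_cons_inj {t d : T} (htd : t ≠ d) (w : List T) {a b : ℕ} {u v : List T}
    (h : repWord (t :: w) a ++ d :: u = repWord (t :: w) b ++ d :: v) : a = b ∧ u = v := by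
  induction a generalizing b with
  | zero =>
    cases b with
    | zero => simpa [repWord] using h
    | succ b =>
      rw [repWord_succ] at h
      simp [repWord, htd.symm] at h
  | succ a ih =>
    cases b with
    | zero =>
      rw [repWord_succ] at h
      simp [repWord, htd] at h
    | succ b =>
      rw [repWord_succ, repWord_succ, List.append_assoc, List.append_assoc] at h
      have := ih (List.append_cancel_left h)
      exact ⟨by rw [this.1], this.2⟩

theorem blockWord_injective {t d : T} (htd : t ≠ d) (w : List T) :
    Function.Injective (blockWord (t :: w) d) := by
  intro l l' h
  induction l generalizing l' with
  | nil =>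
    cases l' with
    | nil => rfl
    | cons b l' => simp [blockWord] at h
  | cons a l ih =>
    cases l' with
    | nil => simp [blockWord] at h
    | cons b l' =>
      obtain ⟨h1, h2⟩ := repWord_append_cons_inj htd w h
      rw [h1, ih h2]

end Words

section LowerBounds

variable {G : Type u} [Group G] (r : ConjClasses G → ℕ) (K : Type w) [Field K]

theorem wordProd_repWord {w : List (Label r)} (hw : wordProd r w = 1) (a : ℕ) :
    wordProd r (repWord w a) = 1 := by
  induction a with
  | zero => simp [repWord]
  | succ a ih => rw [repWord_succ, wordProd_append, hw, ih, one_mul]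

theorem wordProd_blockWord {w : List (Label r)} (hw : wordProd r w = 1) (d : Label r)
    (l : List ℕ) : wordProd r (blockWord w d l) = d.1 ^ l.length := by
  induction l with
  | nil => simp [blockWord]
  | cons a l ih =>
    rw [blockWord, wordProd_append, wordProd_repWord r hw, wordProd_cons, ih, one_mul,
      List.length_cons, pow_succ']

variable {r K} {V : Submodule K (UnitalLeavitt K (hopfGraph r))}

/-- A closed word returns to y, so the same element of V can be multiplied on again; each copy costs
one factor, whatever the length of w. -/
theorem pathElem_append_repWord_mem {x y : G} {w q : List (Label r)} (hw : wordProd r w = 1)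
    (hV : pathElem r K y w ∈ V) (hy : x * wordProd r q = y) {n : ℕ}
    (hq : pathElem r K x q ∈ powLE K V n) (a : ℕ) :
    pathElem r K x (q ++ repWord w a) ∈ powLE K V (n + a) := by
  induction a with
  | zero => simpa [repWord] using hq
  | succ a ih =>
    rw [repWord_succ', ← List.append_assoc, ← pathElem_mul, wordProd_append,
      wordProd_repWord r hw, mul_one, hy]
    exact mul_mem_powLE V ih hV

/-- Copies of w leave the endpoint fixed and each d moves it on by d. The index j counts the
separators already passed, so only the translates of w and d at the first k powers of d are used. No
closed path through d is required. -/
theorem pathElem_append_blockWord_mem {w : List (Label r)} (hw : wordProd r w = 1) (d : Label r)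
    {k : ℕ} (hVw : ∀ i < k, pathElem r K (d.1 ^ i) w ∈ V)
    (hVd : ∀ i < k, pathElem r K (d.1 ^ i) [d] ∈ V) (l : List ℕ) (j : ℕ) (hj : j + l.length ≤ k)
    (q : List (Label r)) (hqd : wordProd r q = d.1 ^ j) (n : ℕ)
    (hq : pathElem r K 1 q ∈ powLE K V n) :
    pathElem r K 1 (q ++ blockWord w d l) ∈ powLE K V (n + l.sum + l.length) := by
  induction l generalizing j q n with
  | nil => simpa [blockWord] using hq
  | cons a l ih =>
    rw [List.length_cons] at hj
    have h1 : pathElem r K 1 (q ++ repWord w a) ∈ powLE K V (n + a) :=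
      pathElem_append_repWord_mem hw (hVw j (by omega)) (by rw [hqd, one_mul]) hq a
    have hp : wordProd r (q ++ repWord w a) = d.1 ^ j := by
      rw [wordProd_append, wordProd_repWord r hw, mul_one, hqd]
    have h2 : pathElem r K 1 ((q ++ repWord w a) ++ [d]) ∈ powLE K V (n + a + 1) := by
      rw [← pathElem_mul, hp, one_mul]
      exact mul_mem_powLE V h1 (hVd j (by omega))
    have h3 := ih (j + 1) (by omega) ((q ++ repWord w a) ++ [d])
      (by rw [wordProd_append, hp, pow_succ]; simp) (n + a + 1) h2
    have e1 : q ++ blockWord w d (a :: l) = (q ++ repWord w a) ++ [d] ++ blockWord w d l := by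
      simp [blockWord]
    have e2 : n + (a :: l).sum + (a :: l).length = n + a + 1 + l.sum + l.length := by
      simp only [List.sum_cons, List.length_cons]
      omega
    rw [e1, e2]
    exact h3

theorem card_le_finrank_powLE [Nonempty (Label r)] (hV : V.FG) (n : ℕ) {ι : Type*} [Fintype ι]
    (p : ι → List (Label r)) (hp : Function.Injective p) (x y : G)
    (hy : ∀ i, wordProd r (p i) = y) (hmem : ∀ i, pathElem r K x (p i) ∈ powLE K V n) :
    Fintype.card ι ≤ Module.finrank K (powLE K V n) := by
  have : Module.Finite K (powLE K V n) := Module.Finite.iff_fg.2 (powLE_fg V hV n)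
  have hli := linearIndependent_pathElem r K x y p hp hy
  have hli' : LinearIndependent K fun i => (⟨pathElem r K x (p i), hmem i⟩ : powLE K V n) :=
    LinearIndependent.of_comp (powLE K V n).subtype hli
  exact hli'.fintype_card_le_finrank

theorem one_le_gkDim_of_closed_word {w : List (Label r)} (hw0 : w ≠ [])
    (hw : wordProd r w = 1) : 1 ≤ gkDim K (LeavittPathAlgebra K (hopfGraph r)) := by
  have : Nonempty (Label r) := ⟨w.head hw0⟩
  let S : Set (UnitalLeavitt K (hopfGraph r)) := {pathElem r K 1 [], pathElem r K 1 w}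
  have hVL : Submodule.span K S ≤ (LeavittPathAlgebra K (hopfGraph r)).toSubmodule := by
    rw [Submodule.span_le]
    rintro _ (rfl | rfl)
    · exact pathElem_mem r K 1 _
    · exact pathElem_mem r K 1 _
  have hfin : (Submodule.span K S).FG := Submodule.fg_span (Set.toFinite S)
  refine le_trans ?_ (growthExponent_le_gkDim _ _ hfin hVL)
  have := le_growthExponent (Submodule.span K S) 1 fun N => ⟨N, le_rfl, ?_⟩
  · simpa using this
  rw [pow_one]
  have hnil : pathElem r K 1 [] ∈ powLE K (Submodule.span K S) 1 :=
    mem_powLE_one _ (Submodule.subset_span (.inl rfl))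
  -- The N words with exponents 0, …, N − 1 need at most 1 + (N − 1) factors, the first one being
  -- the vertex.
  have key := card_le_finrank_powLE hfin N (fun i : Fin N => repWord w i)
    (fun i j h => Fin.ext (repWord_injective hw0 h)) 1 1 (fun i => wordProd_repWord r hw i) ?_
  · simpa using key
  · intro i
    have := pathElem_append_repWord_mem (x := 1) hw (Submodule.subset_span (.inr rfl)) (by simp)
      hnil (i : ℕ)
    exact powLE_mono _ (by omega) this

/-- With k + 1 blocks and exponents below m there are m^(k+1) independent paths, all ending at
d^(k+1), and they need at most 1 + (k + 1)m factors. This beats degree k for large m. -/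
theorem gkDim_eq_top_of_closed_word {t d : Label r} (htd : t ≠ d) {w : List (Label r)}
    (hw : wordProd r (t :: w) = 1) : gkDim K (LeavittPathAlgebra K (hopfGraph r)) = ⊤ := by
  have : Nonempty (Label r) := ⟨t⟩
  have key : ∀ k : ℕ, ((k : ℝ) : EReal) ≤ gkDim K (LeavittPathAlgebra K (hopfGraph r)) := by
    intro k
    let S : Set (UnitalLeavitt K (hopfGraph r)) := insert (pathElem r K 1 [])
      ((fun i : ℕ => pathElem r K (d.1 ^ i) (t :: w)) '' Set.Iio (k + 1) ∪
        (fun i : ℕ => pathElem r K (d.1 ^ i) [d]) '' Set.Iio (k + 1))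
    have hS : S.Finite :=
      (((Set.finite_Iio _).image _).union ((Set.finite_Iio _).image _)).insert _
    have hVL : Submodule.span K S ≤ (LeavittPathAlgebra K (hopfGraph r)).toSubmodule := by
      rw [Submodule.span_le]
      rintro _ (rfl | ⟨i, _, rfl⟩ | ⟨i, _, rfl⟩)
      · exact pathElem_mem r K _ _
      · exact pathElem_mem r K _ _
      · exact pathElem_mem r K _ _
    have hfin : (Submodule.span K S).FG := Submodule.fg_span hS
    refine le_trans ?_ (growthExponent_le_gkDim _ _ hfin hVL)
    refine le_growthExponent _ k fun N => ?_
    -- The extra block pays for the constant: (1 + (k + 1)m)^k ≤ (k + 2)^k m^k ≤ m^(k+1).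
    let m := max (max N 1) ((k + 2) ^ k)
    have hmN : N ≤ m := (le_max_left _ _).trans (le_max_left _ _)
    have hm1 : 1 ≤ m := (le_max_right _ _).trans (le_max_left _ _)
    have hmk : (k + 2) ^ k ≤ m := le_max_right _ _
    refine ⟨1 + (k + 1) * m, by nlinarith, ?_⟩
    have hnil : pathElem r K 1 [] ∈ powLE K (Submodule.span K S) 1 :=
      mem_powLE_one _ (Submodule.subset_span (.inl rfl))
    have hcard := card_le_finrank_powLE hfin (1 + (k + 1) * m)
      (fun a : Fin (k + 1) → Fin m => blockWord (t :: w) d (List.ofFn fun i => (a i : ℕ)))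
      (fun a b h => funext fun i => Fin.ext
        (congrFun (List.ofFn_injective (blockWord_injective htd w h)) i)) 1 (d.1 ^ (k + 1))
      (fun a => by rw [wordProd_blockWord r hw, List.length_ofFn]) ?_
    · calc (1 + (k + 1) * m) ^ k ≤ ((k + 2) * m) ^ k := by gcongr; nlinarith
        _ = (k + 2) ^ k * m ^ k := mul_pow _ _ _
        _ ≤ m * m ^ k := by gcongr
        _ = m ^ (k + 1) := by ring
        _ ≤ _ := by simpa using hcard
    · intro a
      have := pathElem_append_blockWord_mem hw d (k := k + 1)
        (fun i hi => Submodule.subset_span (.inr (.inl ⟨i, hi, rfl⟩)))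
        (fun i hi => Submodule.subset_span (.inr (.inr ⟨i, hi, rfl⟩)))
        (List.ofFn fun i => (a i : ℕ)) 0 (by simp) [] (by simp) 1 hnil
      refine powLE_mono _ ?_ this
      have hsum : (List.ofFn fun i => (a i : ℕ)).sum + (k + 1) ≤ (k + 1) * m := by
        rw [List.sum_ofFn]
        calc ∑ i, (a i : ℕ) + (k + 1) = ∑ i, ((a i : ℕ) + 1) := by simp [Finset.sum_add_distrib]
          _ ≤ ∑ _i : Fin (k + 1), m := Finset.sum_le_sum fun i _ => (a i).2
          _ = (k + 1) * m := by simp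
      rw [List.length_ofFn]
      omega
  rw [EReal.eq_top_iff_forall_lt]
  intro y
  obtain ⟨k, hk⟩ := exists_nat_gt y
  exact (EReal.coe_lt_coe_iff.2 hk).trans_le (key k)

end LowerBounds

end HopfLPA

/-! ### Labels, the semigroup and cycles -/

namespace HopfLPA

open DirectedGraph

universe u

section Combinatorics

variable {G : Type u} [Group G] (r : ConjClasses G → ℕ)

theorem isSubmonoidOf_iff (S : Subsemigroup G) : IsSubmonoidOf S ↔ 1 ∈ S := by
  constructor
  · rintro ⟨M, hM⟩
    rw [← SetLike.mem_coe, ← hM]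
    exact M.one_mem
  · intro h
    exact ⟨⟨S, h⟩, rfl⟩

/-- The number of edges that a vertex of the Hopf graph emits. -/
theorem mk_label : Cardinal.mk (Label r) = ramificationSum r := by
  let e : Label r ≃ Σ C : ConjClasses G, Fin (r C) × C.carrier :=
    { toFun := fun t => ⟨ConjClasses.mk t.1, t.2, t.1, ConjClasses.mem_carrier_mk⟩
      invFun := fun x => ⟨x.2.2.1, Fin.cast (by rw [ConjClasses.mem_carrier_iff_mk_eq.1 x.2.2.2])
        x.2.1⟩
      left_inv := fun t => rfl
      right_inv := by
        rintro ⟨C, i, c, hc⟩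
        obtain rfl := ConjClasses.mem_carrier_iff_mk_eq.1 hc
        rfl }
  rw [Cardinal.mk_congr e, Cardinal.mk_sigma, ramificationSum]
  simp

theorem label_fst_mem (t : Label r) : t.1 ∈ hopfSemigroup r :=
  Subsemigroup.subset_closure (Set.mem_biUnion (x := ConjClasses.mk t.1)
    (show 0 < r (ConjClasses.mk t.1) from t.2.pos) ConjClasses.mem_carrier_mk)

theorem exists_word_of_mem {x : G} (hx : x ∈ hopfSemigroup r) :
    ∃ w : List (Label r), w ≠ [] ∧ wordProd r w = x := by
  unfold hopfSemigroup at hx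
  induction hx using Subsemigroup.closure_induction with
  | mem x hx =>
    obtain ⟨C, hC, hx⟩ := Set.mem_iUnion₂.1 hx
    obtain rfl := ConjClasses.mem_carrier_iff_mk_eq.1 hx
    exact ⟨[⟨x, 0, hC⟩], by simp, by simp⟩
  | mul x y _ _ hx hy =>
    obtain ⟨p, hp, rfl⟩ := hx
    obtain ⟨q, _, rfl⟩ := hy
    exact ⟨p ++ q, by simp [hp], by simp⟩

/-- Along a path, the quotient of the sources of an earlier and a later edge is a nonempty product
of labels. This relation is transitive, and a repeated edge would put 1 into the semigroup. -/
theorem nodup_of_isChain (h : (1 : G) ∉ hopfSemigroup r) (p : List (hopfGraph r).Edge)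
    (hp : p.IsChain Composable) : p.Nodup := by
  let R : (hopfGraph r).Edge → (hopfGraph r).Edge → Prop :=
    fun e f => (e.1 : G)⁻¹ * f.1 ∈ hopfSemigroup r
  have htrans : IsTrans _ R := ⟨fun a b c hab hbc => by
    have := mul_mem hab hbc
    rwa [mul_assoc, mul_inv_cancel_left] at this⟩
  have hchain : p.IsChain R := hp.imp fun e f hef => by
    have : (e.1 : G) * e.2.1 = f.1 := hef
    change (e.1 : G)⁻¹ * f.1 ∈ hopfSemigroup r
    rw [← this, inv_mul_cancel_left]
    exact label_fst_mem r e.2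
  refine hchain.pairwise.imp fun {e f} hef => ?_
  rintro rfl
  have : (e.1 : G)⁻¹ * e.1 ∈ hopfSemigroup r := hef
  rw [inv_mul_cancel] at this
  exact h this

end Combinatorics

end HopfLPA

/-- The Gelfand–Kirillov dimension of the Leavitt path algebra of a Hopf graph. -/
theorem theorem3p2 {G : Type*} [Group G] (r : ConjClasses G → ℕ) (K : Type*) [Field K] :
    ((2 ≤ HopfLPA.ramificationSum r ∧ HopfLPA.IsSubmonoidOf (HopfLPA.hopfSemigroup r)) →
      HopfLPA.gkDim K ((HopfLPA.hopfGraph r).LeavittPathAlgebra K) = ⊤) ∧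
    ((HopfLPA.ramificationSum r = 1 ∧ HopfLPA.IsSubmonoidOf (HopfLPA.hopfSemigroup r)) →
      HopfLPA.gkDim K ((HopfLPA.hopfGraph r).LeavittPathAlgebra K) = 1) ∧
    ((¬ (2 ≤ HopfLPA.ramificationSum r ∧
          HopfLPA.IsSubmonoidOf (HopfLPA.hopfSemigroup r)) ∧
      ¬ (HopfLPA.ramificationSum r = 1 ∧
          HopfLPA.IsSubmonoidOf (HopfLPA.hopfSemigroup r))) →
      HopfLPA.gkDim K ((HopfLPA.hopfGraph r).LeavittPathAlgebra K) = 0) := by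
  simp only [HopfLPA.isSubmonoidOf_iff, ← HopfLPA.mk_label]
  refine ⟨?_, ?_, ?_⟩
  · rintro ⟨h2, h1⟩
    obtain ⟨w, hw0, hw⟩ := HopfLPA.exists_word_of_mem r h1
    obtain ⟨t, w, rfl⟩ := List.exists_cons_of_ne_nil hw0
    have : Nontrivial (HopfLPA.Label r) := Cardinal.one_lt_iff_nontrivial.1
      (lt_of_lt_of_le Cardinal.one_lt_two h2)
    obtain ⟨d, hd⟩ := exists_ne t
    exact HopfLPA.gkDim_eq_top_of_closed_word hd.symm hw
  · rintro ⟨hT, h1⟩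
    obtain ⟨w, hw0, hw⟩ := HopfLPA.exists_word_of_mem r h1
    have : Subsingleton (HopfLPA.Label r) := (Cardinal.eq_one_iff_unique.1 hT).1
    exact le_antisymm (HopfLPA.gkDim_le_one_of_subsingleton r K (w.head hw0))
      (HopfLPA.one_le_gkDim_of_closed_word hw0 hw)
  · rintro ⟨h2, hT⟩
    have h1 : (1 : G) ∉ HopfLPA.hopfSemigroup r := by
      intro h1
      obtain ⟨w, hw0, -⟩ := HopfLPA.exists_word_of_mem r h1
      rcases subsingleton_or_nontrivial (HopfLPA.Label r) with hs | hs
      · exact hT ⟨Cardinal.eq_one_iff_unique.2 ⟨hs, ⟨w.head hw0⟩⟩, h1⟩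
      · refine h2 ⟨?_, h1⟩
        obtain ⟨x, y, hxy⟩ := hs
        exact Cardinal.two_le_iff.2 ⟨x, y, hxy⟩
    exact HopfLPA.DirectedGraph.gkDim_eq_zero_of_acyclic (HopfLPA.nodup_of_isChain r h1)
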